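/- Let $n\ge 0$ and let $G$ be a simple graph with vertex set $[n]=\{1,\dots,n\}$ and edge set $E$. A \emph{tube} of $G$ is a nonempty set $I\subseteq[n]$ whose induced subgraph $G|_I$ is connected. Two tubes $I,J$ are \emph{compatible} if $I\subseteq J$, or $J\subseteq I$, or $I\cup J$ is not a tube. A \emph{tubing} is a set of pairwise compatible tubes, and $\mathrm{MTub}(G)$ is the set of tubings that are maximal under inclusion. For $\mathcal X\in\mathrm{MTub}(G)$ and $I\in\mathcal X$, let $\mathrm{top}_{\mathcal X}(I)$ be the unique element of $I$ that lies in no tube of $\mathcal X$ properly contained in $I$. If $\mathcal X,\mathcal Y\in\mathrm{MTub}(G)$ and $\mathcal Y=(\mathcal X\setminus\{I\})\cup\{J\}$ with $I\in\mathcal X$ and $J\ne I$, write $\mathcal X\to\mathcal Y$ if $\mathrm{top}_{\mathcal X}(I)<\mathrm{top}_{\mathcal Y}(J)$. Let $L_G$ be the set $\mathrm{MTub}(G)$ ordered by the reflexive and transitive closure $\le$ of $\to$. Order the symmetric group $\mathfrak S_n$ by the weak order: $w\le w'$ if and only if $\mathrm{inv}(w)\subseteq\mathrm{inv}(w')$,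 where $\mathrm{inv}(w)$ is the set of pairs $(i,k)$ with $i<k$ such that $k$ precedes $i$ in the one-line notation $w=w_1\cdots w_n$. With this order $\mathfrak S_n$ is a lattice. Let $\Psi_G:\mathfrak S_n\to L_G$ be the map $\Psi_G(w)=\{X_1,\dots,X_n\}$, where $X_j$ is the largest tube of $G$ that contains $w_j$ and is contained in $\{w_1,\dots,w_j\}$. Suppose that $G$ is left-filled, that is, whenever $1\le i<j<k\le n$ and $\{i,k\}\in E$, also $\{i,j\}\in E$. Then $L_G$ is a lattice, and $\Psi_G$ is a join-semilattice map: for all $w,w'\in\mathfrak S_n$, $$\Psi_G(w\vee w')=\Psi_G(w)\vee\Psi_G(w').$$ -/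

import Mathlib

/-- `I` is a tube of `G`: a nonempty vertex set whose induced subgraph is connected. -/
def IsTube {n : ℕ} (G : SimpleGraph (Fin n)) (I : Set (Fin n)) : Prop :=
  I.Nonempty ∧ (G.induce I).Connected

/-- Two tubes are compatible if they are nested or separated (their union is not a tube). -/
def TubesCompatible {n : ℕ} (G : SimpleGraph (Fin n)) (I J : Set (Fin n)) : Prop :=
  (I ⊆ J ∨ J ⊆ I) ∨ ¬ IsTube G (I ∪ J)

/-- A tubing is a collection of pairwise compatible tubes. -/
def IsTubing {n : ℕ} (G : SimpleGraph (Fin n)) (X : Set (Set (Fin n))) : Prop :=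
  (∀ I ∈ X, IsTube G I) ∧ ∀ I ∈ X, ∀ J ∈ X, TubesCompatible G I J

/-- The maximal tubings of `G`: tubings that are maximal with respect to inclusion. -/
structure MaxTubing {n : ℕ} (G : SimpleGraph (Fin n)) where
  tubes : Set (Set (Fin n))
  isMaximal : Maximal (IsTubing G) tubes

/-- `i = top_X(I)`: the element `i` of the tube `I` lies in no tube of `X` that is properly
contained in `I`. (A maximal tubing has exactly one such `i` for each of its tubes `I`.) -/
def IsTopOf {n : ℕ} (X : Set (Set (Fin n))) (I : Set (Fin n)) (i : Fin n) : Prop :=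
  i ∈ I ∧ ∀ J ∈ X, J ⊂ I → i ∉ J

/-- The flip relation `X → Y`: `Y` arises from `X` by exchanging one tube `I` for a different
tube `J`, and `top_X(I) < top_Y(J)`. -/
def Flip {n : ℕ} {G : SimpleGraph (Fin n)} (X Y : MaxTubing G) : Prop :=
  ∃ I J : Set (Fin n), I ∈ X.tubes ∧ J ≠ I ∧ Y.tubes = (X.tubes \ {I}) ∪ {J} ∧
    ∃ i j : Fin n, IsTopOf X.tubes I i ∧ IsTopOf Y.tubes J j ∧ i < j

/-- The order relation of the poset `L_G` of maximal tubings: `X ≤ Y` if there is a (possibly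
empty) sequence of flips `X → ⋯ → Y`. -/
def TubingLE {n : ℕ} {G : SimpleGraph (Fin n)} (X Y : MaxTubing G) : Prop :=
  Relation.ReflTransGen Flip X Y

/-- `G` is left-filled: for `i < j < k`, if `{i, k}` is an edge then so is `{i, j}`. -/
def LeftFilled {n : ℕ} (G : SimpleGraph (Fin n)) : Prop :=
  ∀ i j k : Fin n, i < j → j < k → G.Adj i k → G.Adj i j

/-- The inversions of `w`, written in one-line notation `w 0, w 1, …, w (n - 1)`: the pairs
`(i, k)` of values with `i < k` such that `k` precedes `i`. -/
def inversions {n : ℕ} (w : Equiv.Perm (Fin n)) : Set (Fin n × Fin n) :=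
  {p | p.1 < p.2 ∧ w.symm p.2 < w.symm p.1}

/-- The weak order on permutations: containment of inversion sets. -/
def WeakLE {n : ℕ} (w w' : Equiv.Perm (Fin n)) : Prop :=
  inversions w ⊆ inversions w'

/-- The largest tube of `G` that contains `w j` and is contained in `{w 0, …, w j}`
(the union of all such tubes; see `psiTube_isGreatest`). -/
def psiTube {n : ℕ} (G : SimpleGraph (Fin n)) (w : Equiv.Perm (Fin n)) (j : Fin n) :
    Set (Fin n) :=
  ⋃₀ {I | IsTube G I ∧ w j ∈ I ∧ I ⊆ w '' Set.Iic j}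

theorem isTube_singleton {n : ℕ} (G : SimpleGraph (Fin n)) (v : Fin n) : IsTube G {v} :=
  ⟨Set.singleton_nonempty v, by
    have : Nonempty ({v} : Set (Fin n)) := ⟨⟨v, rfl⟩⟩
    exact ⟨SimpleGraph.Preconnected.of_subsingleton⟩⟩

theorem psiTube_isGreatest {n : ℕ} (G : SimpleGraph (Fin n)) (w : Equiv.Perm (Fin n))
    (j : Fin n) :
    IsGreatest {I | IsTube G I ∧ w j ∈ I ∧ I ⊆ w '' Set.Iic j} (psiTube G w j) := by
  have hs : ({w j} : Set (Fin n)) ∈ {I | IsTube G I ∧ w j ∈ I ∧ I ⊆ w '' Set.Iic j} := by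
    refine ⟨isTube_singleton G _, rfl, ?_⟩
    rintro _ rfl
    exact ⟨j, le_refl j, rfl⟩
  have hm : w j ∈ psiTube G w j := ⟨_, hs, rfl⟩
  refine ⟨⟨⟨⟨_, hm⟩, ?_⟩, hm, ?_⟩, fun I hI => Set.subset_sUnion_of_mem hI⟩
  · apply SimpleGraph.induce_sUnion_connected_of_pairwise_not_disjoint ⟨_, hs⟩
    · intro s t hs ht
      exact ⟨w j, hs.2.1, ht.2.1⟩
    · intro s hs
      exact hs.1.2
  · exact Set.sUnion_subset fun I hI => hI.2.2

theorem psiTube_isMaximal {n : ℕ} (G : SimpleGraph (Fin n)) (w : Equiv.Perm (Fin n)) :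
    Maximal (IsTubing G) (Set.range (psiTube G w)) := by
  have hG := psiTube_isGreatest G w
  have hcomp : ∀ i j : Fin n, i ≤ j →
      TubesCompatible G (psiTube G w i) (psiTube G w j) := by
    intro i j hij
    by_cases h : IsTube G (psiTube G w i ∪ psiTube G w j)
    · left; left
      refine Set.subset_union_left.trans ((hG j).2 ⟨h, Or.inr (hG j).1.2.1, ?_⟩)
      refine Set.union_subset ((hG i).1.2.2.trans ?_) (hG j).1.2.2
      exact Set.image_mono (Set.Iic_subset_Iic.2 hij)
    · exact Or.inr h
  have hsymm : ∀ I J, TubesCompatible G I J → TubesCompatible G J I := by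
    intro I J h
    unfold TubesCompatible at *
    rw [Set.union_comm J I]
    tauto
  refine ⟨⟨?_, ?_⟩, ?_⟩
  · rintro _ ⟨j, rfl⟩
    exact (hG j).1.1
  · rintro _ ⟨i, rfl⟩ _ ⟨j, rfl⟩
    rcases le_total i j with h | h
    · exact hcomp i j h
    · exact hsymm _ _ (hcomp j i h)
  · intro Y hY hle T hT
    have hTt := hY.1 T hT
    obtain ⟨j, hjT, hj⟩ := Set.exists_max_image (w ⁻¹' T) id (Set.toFinite _)
      (by obtain ⟨v, hv⟩ := hTt.1; exact ⟨w.symm v, by simpa using hv⟩)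
    have hsub : T ⊆ psiTube G w j := by
      refine (hG j).2 ⟨hTt, hjT, fun v hv => ⟨w.symm v, hj _ (by simpa using hv), by simp⟩⟩
    refine ⟨j, subset_antisymm ?_ hsub⟩
    intro u hu
    by_contra huT
    obtain ⟨p⟩ := (hG j).1.1.2.preconnected ⟨w j, (hG j).1.2.1⟩ ⟨u, hu⟩
    obtain ⟨d, -, hd1, hd2⟩ := p.exists_boundary_dart {v | (v : Fin n) ∈ T} hjT huT
    have hadj : G.Adj (d.fst : Fin n) (d.snd : Fin n) := d.adj
    obtain ⟨q, hq, hqe⟩ := (hG j).1.2.2 d.snd.2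
    have hqT : w q ∉ T := by rw [hqe]; exact hd2
    have hqj : q < j := lt_of_le_of_ne hq (by rintro rfl; exact hqT hjT)
    have hwj : w j ∉ psiTube G w q := by
      intro h
      obtain ⟨r, hr, hre⟩ := (hG q).1.2.2 h
      have := w.injective hre
      subst this
      exact absurd hqj (not_lt.2 hr)
    rcases hY.2 T hT _ (hle ⟨q, rfl⟩) with (h | h) | h
    · exact hwj (h hjT)
    · exact hqT (h (hG q).1.2.1)
    · exact h ⟨hTt.1.inl, SimpleGraph.connected_induce_union hTt.2.preconnected
        (hG q).1.1.2.preconnected hd1 (hqe ▸ (hG q).1.2.1) hadj⟩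

/-- The canonical map `Ψ_G` from permutations to maximal tubings,
`Ψ_G(w) = {X_j}` with `X_j` the largest tube in `{w 0, …, w j}` containing `w j`. -/
def Psi {n : ℕ} (G : SimpleGraph (Fin n)) (w : Equiv.Perm (Fin n)) : MaxTubing G where
  tubes := Set.range (psiTube G w)
  isMaximal := psiTube_isMaximal G w

/-! A maximal tubing `X` is encoded by its smallest tubes `down X.tubes v`, one for each vertex `v`,
and the permutations in the fibre of `Psi G` over `X` are the linear extensions of the order `u ∈
down X.tubes v`. When `G` is left-filled, each fibre has a largest element, `maxExtension`, which
inverts `i < k` exactly when `i ∉ down X.tubes k`; left-filledness makes this set of pairs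
transitive.

The theorem then says that `Psi G` is the lower adjoint of a Galois insertion with upper adjoint
`maxExtension`: lower adjoints preserve joins, and the lattice structure descends from the weak
order. Two monotonicity facts carry this. `Psi G` is monotone for every graph, since an adjacent
swap fixes the tubing or flips it upwards (`tubingLE_Psi_trans_swap`). `maxExtension` is monotone
because an upward flip can only shrink the part of `down X.tubes k` below `k` (`Flip.mem_down`);
this again uses left-filledness. -/

/-! ### Tubes, components and left-filled graphs -/

theorem IsTube.union_of_adj {n : ℕ} {G : SimpleGraph (Fin n)} {I J : Set (Fin n)}
    (hI : IsTube G I) (hJ : IsTube G J) {x y : Fin n} (hx : x ∈ I) (hy : y ∈ J)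
    (h : G.Adj x y) : IsTube G (I ∪ J) :=
  ⟨hI.1.inl, SimpleGraph.connected_induce_union hI.2.preconnected hJ.2.preconnected hx hy h⟩

/-- A tube meeting both a set and its complement has an edge crossing between them. -/
theorem IsTube.exists_boundary {n : ℕ} {G : SimpleGraph (Fin n)} {I : Set (Fin n)}
    (hI : IsTube G I) (S : Set (Fin n)) {x y : Fin n} (hx : x ∈ I) (hy : y ∈ I)
    (hxS : x ∈ S) (hyS : y ∉ S) : ∃ u ∈ I, ∃ v ∈ I, u ∈ S ∧ v ∉ S ∧ G.Adj u v := by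
  obtain ⟨p⟩ := hI.2.preconnected ⟨x, hx⟩ ⟨y, hy⟩
  obtain ⟨d, -, hd1, hd2⟩ := p.exists_boundary_dart {v | (v : Fin n) ∈ S} hxS hyS
  exact ⟨d.fst, d.fst.2, d.snd, d.snd.2, hd1, hd2, d.adj⟩

/-- The component of `v` in the subgraph induced on `S`. -/
def component {n : ℕ} (G : SimpleGraph (Fin n)) (S : Set (Fin n)) (v : Fin n) : Set (Fin n) :=
  ⋃₀ {I | IsTube G I ∧ v ∈ I ∧ I ⊆ S}

section component

variable {n : ℕ} {G : SimpleGraph (Fin n)} {S T : Set (Fin n)} {u v x : Fin n}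

theorem subset_component {I : Set (Fin n)} (hI : IsTube G I) (hv : v ∈ I) (hS : I ⊆ S) :
    I ⊆ component G S v :=
  Set.subset_sUnion_of_mem ⟨hI, hv, hS⟩

theorem component_subset : component G S v ⊆ S :=
  Set.sUnion_subset fun _ hI => hI.2.2

theorem mem_component_self (hv : v ∈ S) : v ∈ component G S v :=
  subset_component (isTube_singleton G v) rfl (Set.singleton_subset_iff.2 hv) rfl

theorem isTube_component (hv : v ∈ S) : IsTube G (component G S v) := by
  refine ⟨⟨v, mem_component_self hv⟩, ?_⟩
  apply SimpleGraph.induce_sUnion_connected_of_pairwise_not_disjoint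
  · exact ⟨{v}, isTube_singleton G v, rfl, Set.singleton_subset_iff.2 hv⟩
  · intro s t hs ht
    exact ⟨v, hs.2.1, ht.2.1⟩
  · intro s hs
    exact hs.1.2

theorem component_mono (h : S ⊆ T) : component G S v ⊆ component G T v :=
  Set.sUnion_mono fun _ hI => ⟨hI.1, hI.2.1, hI.2.2.trans h⟩

theorem mem_component_of_adj (hv : v ∈ S) (hx : x ∈ component G S v) (hu : u ∈ S)
    (h : G.Adj x u) : u ∈ component G S v :=
  subset_component ((isTube_component hv).union_of_adj (isTube_singleton G u) hx rfl h)
    (Or.inl (mem_component_self hv))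
    (Set.union_subset component_subset (Set.singleton_subset_iff.2 hu)) (Or.inr rfl)

theorem component_eq_of_mem (hv : v ∈ S) (hu : u ∈ component G S v) :
    component G S u = component G S v := by
  have huS := component_subset hu
  have h1 : component G S v ⊆ component G S u :=
    subset_component (isTube_component hv) hu component_subset
  exact subset_antisymm
    (subset_component (isTube_component huS) (h1 (mem_component_self hv)) component_subset) h1

theorem component_diff_singleton (hv : v ∈ S) (hu : u ∉ component G S v) :
    component G (S \ {u}) v = component G S v :=
  subset_antisymm (component_mono Set.sdiff_subset)
    (subset_component (isTube_component hv) (mem_component_self hv) fun _ hx =>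
      ⟨component_subset hx, fun h => hu (h ▸ hx)⟩)

end component

/-- In a left-filled graph, the elements of a tube that are at most `k` are connected to `k`
within the elements that are at most `k`. -/
theorem LeftFilled.mem_component {n : ℕ} {G : SimpleGraph (Fin n)} (hG : LeftFilled G)
    {I : Set (Fin n)} (hI : IsTube G I) {i k : Fin n} (hi : i ∈ I) (hk : k ∈ I) (hik : i ≤ k) :
    i ∈ component G (I ∩ Set.Iic k) k := by
  have hkS : k ∈ I ∩ Set.Iic k := ⟨hk, le_refl k⟩
  by_contra hn
  -- An edge leaving the part of `I ∩ Set.Iic k` missed by the component cannot enter the component,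
  -- so it ends above `k`; left-filledness then joins `u` to `k`.
  obtain ⟨u, huI, v, hvI, ⟨huk, hu⟩, hv, huv⟩ := hI.exists_boundary
    {v | v ≤ k ∧ v ∉ component G (I ∩ Set.Iic k) k} hi hk ⟨hik, hn⟩
    fun h => h.2 (mem_component_self hkS)
  have huS : u ∈ I ∩ Set.Iic k := ⟨huI, huk⟩
  have hne : u ≠ k := fun h => hu (h ▸ mem_component_self (h ▸ huS))
  by_cases hvk : v ≤ k
  · have hvc : v ∈ component G (I ∩ Set.Iic k) k := by
      by_contra h
      exact hv ⟨hvk, h⟩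
    exact hu (mem_component_of_adj hkS hvc huS huv.symm)
  · have := hG u k v (lt_of_le_of_ne huk hne) (not_le.1 hvk) huv
    exact hu (mem_component_of_adj hkS (mem_component_self hkS) huS this.symm)

/-- Some edge of the tube jumps over `j`, and left-filledness joins its smaller end to `j`. -/
theorem LeftFilled.exists_adj_of_between {n : ℕ} {G : SimpleGraph (Fin n)} (hG : LeftFilled G)
    {I : Set (Fin n)} (hI : IsTube G I) {i j k : Fin n} (hi : i ∈ I) (hk : k ∈ I)
    (hij : i < j) (hjk : j < k) (hj : j ∉ I) : ∃ x ∈ I, G.Adj x j := by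
  obtain ⟨u, hu, v, hv, huj, hvj, huv⟩ :=
    hI.exists_boundary (Set.Iio j) hi hk hij (not_lt.2 hjk.le)
  refine ⟨u, hu, hG u j v huj (lt_of_le_of_ne (not_lt.1 hvj) ?_) huv⟩
  rintro rfl
  exact hj hv

/-! ### Smallest tubes and the fibres of `Psi` -/

theorem MaxTubing.ext_tubes {n : ℕ} {G : SimpleGraph (Fin n)} {X Y : MaxTubing G}
    (h : X.tubes = Y.tubes) : X = Y := by
  cases X; cases Y; cases h; rfl

/-- The smallest tube of `X` containing `v`. -/
def down {n : ℕ} (X : Set (Set (Fin n))) (v : Fin n) : Set (Fin n) :=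
  ⋂₀ {I | I ∈ X ∧ v ∈ I}

theorem IsTubing.nested_of_adj {n : ℕ} {G : SimpleGraph (Fin n)} {X : Set (Set (Fin n))}
    (hX : IsTubing G X) {I J : Set (Fin n)} (hI : I ∈ X) (hJ : J ∈ X) {x y : Fin n}
    (hx : x ∈ I) (hy : y ∈ J) (h : G.Adj x y) : I ⊆ J ∨ J ⊆ I :=
  (hX.2 I hI J hJ).resolve_right fun h' => h' ((hX.1 I hI).union_of_adj (hX.1 J hJ) hx hy h)

/-- A tubing all of whose tubes precede their neighbours in `w` is contained in `Ψ(w)`. -/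
theorem IsTubing.subset_Psi {n : ℕ} {G : SimpleGraph (Fin n)} {X : Set (Set (Fin n))}
    (hX : IsTubing G X) (w : Equiv.Perm (Fin n))
    (hw : ∀ I ∈ X, ∀ x ∈ I, ∀ y ∈ I, ∀ u, u ∉ I → G.Adj y u → w.symm x < w.symm u) :
    X ⊆ (Psi G w).tubes := by
  intro I hI
  obtain ⟨v, hv⟩ := (hX.1 I hI).1
  obtain ⟨x, hx, hmax⟩ := Set.exists_max_image I w.symm (Set.toFinite _) ⟨v, hv⟩
  have hg := psiTube_isGreatest G w (w.symm x)
  have hsub : I ⊆ psiTube G w (w.symm x) :=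
    hg.2 ⟨hX.1 I hI, by simpa using hx, fun u hu => ⟨w.symm u, hmax u hu, by simp⟩⟩
  refine ⟨w.symm x, subset_antisymm ?_ hsub⟩
  intro u hu
  by_contra huI
  obtain ⟨y, -, z, hz, hyI, hzI, hyz⟩ := hg.1.1.exists_boundary I (hsub hx) hu hx huI
  have h1 := hw I hI x hx y hyI z hzI hyz
  obtain ⟨q, hq, rfl⟩ := hg.1.2.2 hz
  rw [Equiv.symm_apply_apply] at h1
  exact absurd h1 (not_lt.2 hq)

/-- Sort the vertices by the size of their smallest tube. A neighbour outside a tube `I` has a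
smallest tube strictly containing `I`, so it comes after all of `I`. -/
theorem Psi_surjective {n : ℕ} (G : SimpleGraph (Fin n)) (X : MaxTubing G) :
    ∃ w, Psi G w = X := by
  classical
  have hX := X.isMaximal.1
  let f : Fin n → ℕ := fun v => (down X.tubes v).ncard
  -- The default `n + 1` exceeds the size of every tube, so vertices not known to be covered come
  -- last.
  let f' : Fin n → ℕ := fun v => if ∃ I ∈ X.tubes, v ∈ I then f v else n + 1
  have hmono := Tuple.monotone_sort f'
  have key : ∀ x u, f' x < f' u → (Tuple.sort f').symm x < (Tuple.sort f').symm u := by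
    intro x u h
    by_contra hle
    have := hmono (not_lt.1 hle)
    simp at this
    omega
  refine ⟨Tuple.sort f', MaxTubing.ext_tubes ?_⟩
  refine X.isMaximal.eq_of_ge (Psi G _).isMaximal.1 (hX.subset_Psi _ ?_)
  intro I hI x hx y hy u hu hyu
  apply key
  have h1 : f' x ≤ I.ncard := by
    have : f' x = f x := if_pos ⟨I, hI, hx⟩
    rw [this]
    exact Set.ncard_le_ncard (Set.sInter_subset_of_mem ⟨hI, hx⟩) (Set.toFinite _)
  refine h1.trans_lt ?_
  by_cases h : ∃ J ∈ X.tubes, u ∈ J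
  · have : f' u = f u := if_pos h
    rw [this]
    have hsub : I ∪ {u} ⊆ down X.tubes u := by
      refine Set.union_subset ?_ (Set.singleton_subset_iff.2 fun J hJ => hJ.2)
      refine Set.subset_sInter fun J hJ => ?_
      exact (hX.nested_of_adj hI hJ.1 hy hJ.2 hyu).resolve_right fun h => hu (h hJ.2)
    refine Set.ncard_lt_ncard ?_ (Set.toFinite _)
    exact ⟨Set.subset_union_left.trans hsub, fun h => hu (h (hsub (Or.inr rfl)))⟩
  · have : f' u = n + 1 := if_neg h
    rw [this]
    have := Set.ncard_le_card I
    rw [Nat.card_fin] at this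
    omega

/-- Every tube of `Psi G w` is a component of a prefix of `w`; one containing `v` comes from a
prefix that reaches `v`. -/
theorem down_Psi {n : ℕ} (G : SimpleGraph (Fin n)) (w : Equiv.Perm (Fin n)) (v : Fin n) :
    down (Psi G w).tubes v = component G {u | w.symm u ≤ w.symm v} v := by
  have hT : ∀ j, psiTube G w j = component G {u | w.symm u ≤ j} (w j) := by
    intro j
    have : w '' Set.Iic j = {u | w.symm u ≤ j} := by
      rw [Equiv.image_eq_preimage_symm]; rfl
    rw [← this]; rfl
  have hv : v ∈ {u | w.symm u ≤ w.symm v} := le_refl (w.symm v)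
  apply subset_antisymm
  · apply Set.sInter_subset_of_mem
    refine ⟨⟨w.symm v, ?_⟩, mem_component_self hv⟩
    rw [hT, Equiv.apply_symm_apply]
  · apply Set.subset_sInter
    rintro _ ⟨⟨j, rfl⟩, hvj⟩
    rw [hT] at hvj ⊢
    have hvj' : w.symm v ≤ j := component_subset hvj
    have hj : w j ∈ {u | w.symm u ≤ j} := by simp
    rw [← component_eq_of_mem hj hvj]
    exact component_mono fun u (hu : _ ≤ _) => hu.trans hvj'

theorem MaxTubing.tubes_eq_range {n : ℕ} {G : SimpleGraph (Fin n)} (X : MaxTubing G) :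
    X.tubes = Set.range (down X.tubes) := by
  obtain ⟨w, rfl⟩ := Psi_surjective G X
  have : ∀ j, psiTube G w j = down (Psi G w).tubes (w j) := by
    intro j
    rw [down_Psi, Equiv.symm_apply_apply]
    have : w '' Set.Iic j = {u | w.symm u ≤ j} := by
      rw [Equiv.image_eq_preimage_symm]; rfl
    rw [← this]; rfl
  have h2 : psiTube G w = down (Psi G w).tubes ∘ w := funext this
  change Set.range (psiTube G w) = _
  rw [h2, Set.range_comp, w.surjective.range_eq, Set.image_univ]

section down

variable {n : ℕ} {G : SimpleGraph (Fin n)} (X : MaxTubing G) {u v : Fin n}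

theorem down_mem (v : Fin n) : down X.tubes v ∈ X.tubes :=
  X.tubes_eq_range.ge ⟨v, rfl⟩

theorem isTube_down (v : Fin n) : IsTube G (down X.tubes v) :=
  X.isMaximal.1.1 _ (down_mem X v)

theorem mem_down_self {X : Set (Set (Fin n))} (v : Fin n) : v ∈ down X v :=
  fun _ hJ => hJ.2

theorem down_subset {X : Set (Set (Fin n))} {I : Set (Fin n)} (hI : I ∈ X) (hv : v ∈ I) :
    down X v ⊆ I :=
  Set.sInter_subset_of_mem ⟨hI, hv⟩

variable {X} in
theorem down_subset_down (h : u ∈ down X.tubes v) : down X.tubes u ⊆ down X.tubes v :=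
  down_subset (down_mem X v) h

variable {X} in
theorem eq_of_mem_down_of_mem_down (h : u ∈ down X.tubes v) (h' : v ∈ down X.tubes u) :
    u = v := by
  obtain ⟨w, rfl⟩ := Psi_surjective G X
  rw [down_Psi] at h h'
  have h1 : w.symm u ≤ w.symm v := component_subset h
  have h2 : w.symm v ≤ w.symm u := component_subset h'
  exact w.symm.injective (le_antisymm h1 h2)

theorem down_injective : Function.Injective (down X.tubes) := fun u v h =>
  eq_of_mem_down_of_mem_down (X := X) (h ▸ mem_down_self u) (h.symm ▸ mem_down_self v)

variable {X} in
theorem down_subset_down_of_adj {x : Fin n} (hx : x ∈ down X.tubes v) (hu : u ∉ down X.tubes v)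
    (h : G.Adj x u) : down X.tubes v ⊆ down X.tubes u :=
  (X.isMaximal.1.nested_of_adj (down_mem X v) (down_mem X u) hx (mem_down_self u)
    h).resolve_right fun h => hu (h (mem_down_self u))

variable {X} in
theorem isTopOf_iff {I : Set (Fin n)} (hI : I ∈ X.tubes) :
    IsTopOf X.tubes I v ↔ I = down X.tubes v := by
  constructor
  · rintro ⟨hv, h⟩
    by_contra hne
    exact h _ (down_mem X v) ((down_subset hI hv).ssubset_of_ne (Ne.symm hne)) (mem_down_self v)
  · rintro rfl
    exact ⟨mem_down_self v, fun J hJ hlt hv => hlt.2 (down_subset hJ hv)⟩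

/-- Linear extensions of the tree order of `X` form the fibre of `Ψ` over `X`. -/
theorem Psi_eq_of_forall_mem_down (w : Equiv.Perm (Fin n))
    (hw : ∀ u v, u ∈ down X.tubes v → w.symm u ≤ w.symm v) : Psi G w = X := by
  refine MaxTubing.ext_tubes
    (X.isMaximal.eq_of_ge (Psi G _).isMaximal.1 (X.isMaximal.1.subset_Psi w ?_))
  intro I hI x hx y hy u hu hyu
  rw [X.tubes_eq_range] at hI
  obtain ⟨v, rfl⟩ := hI
  have hsub := down_subset_down_of_adj hy hu hyu
  refine lt_of_le_of_ne (hw x u (hsub hx)) fun h => hu ?_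
  rwa [← w.symm.injective h]

end down

/-! ### Inversion sets and the weak order -/

/-- The position of `a` is the number of its predecessors. -/
theorem exists_perm_of_isStrictTotalOrder {n : ℕ} (r : Fin n → Fin n → Prop)
    (hirr : ∀ a, ¬ r a a) (htrans : ∀ a b c, r a b → r b c → r a c)
    (htot : ∀ a b, a ≠ b → r a b ∨ r b a) :
    ∃ w : Equiv.Perm (Fin n), ∀ a b, w.symm a < w.symm b ↔ r a b := by
  have hlt : ∀ a, {b | r b a}.ncard < n := by
    intro a
    have h : ({b | r b a} : Set (Fin n)) ⊂ Set.univ :=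
      (Set.subset_univ _).ssubset_of_ne fun h => hirr a (h.ge (Set.mem_univ a))
    simpa [Set.ncard_univ] using Set.ncard_lt_ncard h (Set.toFinite _)
  let f : Fin n → Fin n := fun a => ⟨{b | r b a}.ncard, hlt a⟩
  have hmono : ∀ a b, r a b → f a < f b := fun a b h =>
    Set.ncard_lt_ncard (t := {c | r c b})
      ⟨fun c hc => htrans c a b hc h, fun h' => hirr a (h' h)⟩ (Set.toFinite _)
  have hinj : Function.Injective f := by
    intro a b hab
    by_contra hne
    rcases htot a b hne with h | h
    · exact (hmono a b h).ne hab
    · exact (hmono b a h).ne' hab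
  refine ⟨(Equiv.ofBijective f (Finite.injective_iff_bijective.1 hinj)).symm, fun a b => ?_⟩
  change f a < f b ↔ r a b
  refine ⟨fun h => ?_, hmono a b⟩
  have hne : a ≠ b := fun e => h.ne (congrArg f e)
  exact (htot a b hne).resolve_right fun h' => h.not_gt (hmono b a h')

/-- A transitive and cotransitive set of pairs is the inversion set of a permutation. -/
theorem exists_perm_of_biclosed {n : ℕ} (B : Fin n → Fin n → Prop)
    (h1 : ∀ i j k, i < j → j < k → B i j → B j k → B i k)
    (h2 : ∀ i j k, i < j → j < k → B i k → B i j ∨ B j k) :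
    ∃ w : Equiv.Perm (Fin n), ∀ i k, i < k → (w.symm k < w.symm i ↔ B i k) := by
  obtain ⟨w, hw⟩ := exists_perm_of_isStrictTotalOrder
    (fun a b => (a < b ∧ ¬ B a b) ∨ (b < a ∧ B b a)) (by simp) (by
      intro a b c
      have := h1 a b c
      have := h1 b c a
      have := h1 c a b
      have := h1 c b a
      have := h1 a c b
      have := h1 b a c
      have := h2 a b c
      have := h2 b c a
      have := h2 c a b
      have := h2 c b a
      have := h2 a c b
      have := h2 b a c
      grind) (by
      intro a b hab
      rcases lt_or_gt_of_ne hab with h | h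
      · by_cases hB : B a b <;> simp [h, hB]
      · by_cases hB : B b a <;> simp [h, hB])
  refine ⟨w, fun i k hik => ?_⟩
  rw [hw]
  simp [hik, hik.not_gt]

section WeakOrder

variable {n : ℕ} {w w' : Equiv.Perm (Fin n)}

theorem WeakLE.not_inv (h : WeakLE w w') {i k : Fin n} (hik : i ≤ k)
    (hw : w'.symm i ≤ w'.symm k) : w.symm i ≤ w.symm k := by
  rcases hik.eq_or_lt with rfl | hik
  · exact le_rfl
  · by_contra hn
    exact hw.not_gt (h (show (i, k) ∈ inversions w from ⟨hik, not_le.1 hn⟩)).2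

theorem Equiv.Perm.eq_of_strictMono (h : StrictMono fun i => w'.symm (w i)) : w = w' := by
  have h1 : (fun i => w'.symm (w i)) = id := by
    rw [← StrictMono.range_inj h strictMono_id]
    exact (w.trans w'.symm).surjective.range_eq.trans Set.range_id.symm
  ext1 i
  rw [← Equiv.symm_apply_eq]
  exact congrFun h1 i

theorem WeakLE.antisymm (h : WeakLE w w') (h' : WeakLE w' w) : w = w' := by
  have hlt : ∀ a b, w.symm a ≤ w.symm b → w'.symm a ≤ w'.symm b := by
    intro a b hab
    rcases le_total a b with h1 | h1
    · exact h'.not_inv h1 hab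
    · rcases h1.eq_or_lt with rfl | h1
      · exact le_rfl
      · by_contra hn
        have := h.not_inv h1.le (not_le.1 hn).le
        exact hn (by rw [w.symm.injective (le_antisymm hab this)])
  have hm : Monotone fun i => w'.symm (w i) := fun i j hij => hlt _ _ (by simpa using hij)
  exact Equiv.Perm.eq_of_strictMono
    (hm.strictMono_of_injective (w'.symm.injective.comp w.injective))

/-- The transitive closure of the union of the inversion sets of a set of permutations. -/
theorem exists_isLUB_weakLE (S : Set (Equiv.Perm (Fin n))) :
    ∃ u, (∀ w ∈ S, WeakLE w u) ∧ ∀ v, (∀ w ∈ S, WeakLE w v) → WeakLE u v := by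
  let R : Fin n → Fin n → Prop := fun i k => ∃ w ∈ S, (i, k) ∈ inversions w
  have hR2 : ∀ i j k, i < j → j < k → R i k → R i j ∨ R j k := by
    rintro i j k hij hjk ⟨w, hw, -, h⟩
    rcases lt_or_ge (w.symm j) (w.symm i) with h' | h'
    · exact Or.inl ⟨w, hw, hij, h'⟩
    · exact Or.inr ⟨w, hw, hjk, h.trans_le h'⟩
  obtain ⟨u, hu⟩ := exists_perm_of_biclosed (Relation.TransGen R)
    (fun _ _ _ _ _ => Relation.TransGen.trans) (by
      intro i j k hij hjk h
      -- Cotransitivity passes to the transitive closure: compare `j` with the start `b` of the last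
      -- step of the chain.
      induction h with
      | single h => exact (hR2 i j _ hij hjk h).imp .single .single
      | @tail b c hb hbc ih =>
        rcases lt_trichotomy j b with h | rfl | h
        · exact (ih h).imp_right fun h => h.tail hbc
        · exact Or.inl hb
        · exact (hR2 b j c h hjk hbc).imp (fun h => hb.tail h) .single)
  refine ⟨u, fun w hw p hp => ?_, fun v hv p hp => ?_⟩
  · exact ⟨hp.1, (hu _ _ hp.1).2 (.single ⟨w, hw, hp⟩)⟩
  · have h := (hu _ _ hp.1).1 hp.2
    refine ⟨hp.1, ?_⟩
    have : ∀ i k, Relation.TransGen R i k → v.symm k < v.symm i := by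
      intro i k h
      induction h with
      | single h => obtain ⟨w, hw, h⟩ := h; exact (hv w hw h).2
      | tail _ h ih => obtain ⟨w, hw, h⟩ := h; exact (hv w hw h).2.trans ih
    exact this _ _ h

/-- The weak order on permutations, as a complete lattice. -/
noncomputable abbrev weakOrder (n : ℕ) : CompleteLattice (Equiv.Perm (Fin n)) :=
  letI : PartialOrder (Equiv.Perm (Fin n)) :=
    { le := WeakLE
      le_refl := fun _ => subset_rfl
      le_trans := fun _ _ _ => Set.Subset.trans
      le_antisymm := fun _ _ => WeakLE.antisymm }
  letI : SupSet (Equiv.Perm (Fin n)) := ⟨fun S => (exists_isLUB_weakLE S).choose⟩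
  completeLatticeOfSup _ fun S =>
    ⟨(exists_isLUB_weakLE S).choose_spec.1, (exists_isLUB_weakLE S).choose_spec.2⟩

/-- Otherwise any two consecutive letters of `w` occur in the same order in `w'`, which forces `w =
w'`. -/
theorem WeakLE.exists_ascent (h : WeakLE w w') (hne : w ≠ w') :
    ∃ a b, a < b ∧ (w.symm a).val + 1 = w.symm b ∧ (a, b) ∈ inversions w' := by
  by_contra! hn
  apply hne
  have key : ∀ i j : Fin n, i.val + 1 = j → w'.symm (w i) < w'.symm (w j) := by
    intro i j hij
    have hlt : i < j := Fin.lt_def.2 (by omega)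
    rcases lt_trichotomy (w i) (w j) with h1 | h1 | h1
    · have h2 := hn (w i) (w j) h1 (by simpa using hij)
      refine lt_of_le_of_ne (not_lt.1 fun h3 => h2 ⟨h1, h3⟩) fun e => hlt.ne ?_
      exact w.injective (w'.symm.injective e)
    · exact absurd (w.injective h1) hlt.ne
    · exact (h (show (w j, w i) ∈ inversions w from ⟨h1, by simpa using hlt⟩)).2
  apply Equiv.Perm.eq_of_strictMono
  cases n with
  | zero => exact fun i => i.elim0
  | succ n => exact Fin.strictMono_iff_lt_succ.2 fun i => key _ _ (by simp)

theorem inversions_trans_swap {a b : Fin n} (hab : a < b) (hw : (w.symm a).val + 1 = w.symm b) :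
    inversions (w.trans (Equiv.swap a b)) = insert (a, b) (inversions w) := by
  ext ⟨x, y⟩
  have hinj : ∀ u v, (w.symm u).val = w.symm v → u = v := fun u v h =>
    w.symm.injective (Fin.ext h)
  have := hinj x a
  have := hinj x b
  have := hinj y a
  have := hinj y b
  simp only [inversions, Set.mem_ofPred_eq, Equiv.symm_trans_apply, Equiv.symm_swap,
    Equiv.swap_apply_def, Set.mem_insert_iff, Prod.mk.injEq, Fin.lt_def] at *
  grind

end WeakOrder

/-! ### Monotonicity of `Psi` and of the largest linear extension -/

section Flips

variable {n : ℕ} {G : SimpleGraph (Fin n)} {X Y : MaxTubing G}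

/-- Exchanging two adjacent letters `a < b` of a permutation either preserves its image under
`Ψ` or flips it upwards. -/
theorem tubingLE_Psi_trans_swap (w : Equiv.Perm (Fin n)) {a b : Fin n} (hab : a < b)
    (hw : (w.symm a).val + 1 = w.symm b) :
    TubingLE (Psi G w) (Psi G (w.trans (Equiv.swap a b))) := by
  set u := w.trans (Equiv.swap a b) with hu
  set S := {x | w.symm x ≤ w.symm b} with hS
  have hinj : ∀ u v, (w.symm u).val = w.symm v → u = v := fun u v h =>
    w.symm.injective (Fin.ext h)
  have hus : ∀ v, u.symm v = w.symm (Equiv.swap a b v) := fun v => by simp [hu]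
  -- A prefix ending at another letter contains both of `a`, `b` or neither.
  have hother : ∀ v, v ≠ a → v ≠ b → down (Psi G u).tubes v = down (Psi G w).tubes v := by
    intro v hva hvb
    rw [down_Psi, down_Psi]
    congr 1
    ext x
    have := hinj v a
    have := hinj v b
    simp only [Set.mem_ofPred_eq, hus, Equiv.swap_apply_def, Fin.le_def]
    grind
  have hSa : a ∈ S := by simp only [hS, Set.mem_ofPred_eq, Fin.le_def]; omega
  have hSb : b ∈ S := le_refl (w.symm b)
  have hwa : down (Psi G w).tubes a = component G (S \ {b}) a := by
    rw [down_Psi]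
    congr 1
    ext x
    have := hinj x b
    simp only [hS, Set.mem_ofPred_eq, Fin.le_def, Set.mem_sdiff, Set.mem_singleton_iff]
    grind
  have hwb : down (Psi G w).tubes b = component G S b := down_Psi G w b
  have hua : down (Psi G u).tubes a = component G S a := by
    rw [down_Psi]
    congr 1
    ext x
    simp only [hS, Set.mem_ofPred_eq, hus, Equiv.swap_apply_def, Fin.le_def]
    grind
  have hub : down (Psi G u).tubes b = component G (S \ {a}) b := by
    rw [down_Psi]
    congr 1
    ext x
    have := hinj x a
    have := hinj x b
    simp only [hS, Set.mem_ofPred_eq, hus, Equiv.swap_apply_def, Fin.le_def, Set.mem_sdiff,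
      Set.mem_singleton_iff]
    grind
  -- If `a` and `b` share a component of the prefix `S`, its top changes from `b` to `a` and just
  -- one tube is exchanged. Otherwise deleting one letter leaves the component of the other intact.
  by_cases hc : a ∈ component G S b
  · have hab' : down (Psi G u).tubes a = down (Psi G w).tubes b := by
      rw [hua, hwb, component_eq_of_mem hSb hc]
    refine Relation.ReflTransGen.single ⟨down (Psi G w).tubes a, down (Psi G u).tubes b,
      down_mem _ _, ?_, ?_, a, b, (isTopOf_iff (down_mem _ _)).2 rfl,
      (isTopOf_iff (down_mem _ _)).2 rfl, hab⟩
    · intro h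
      have : b ∈ component G (S \ {b}) a := by
        rw [← hwa, ← h]
        exact mem_down_self b
      exact (component_subset this).2 rfl
    · have hi := down_injective (Psi G w)
      ext I
      rw [(Psi G u).tubes_eq_range, Set.mem_union, Set.mem_sdiff, Set.mem_singleton_iff,
        Set.mem_singleton_iff, ← MaxTubing.tubes_eq_range]
      constructor
      · intro hI
        rw [(Psi G u).tubes_eq_range] at hI
        obtain ⟨v, rfl⟩ := hI
        by_cases hvb : v = b
        · exact Or.inr (by rw [hvb])
        · left
          by_cases hva : v = a
          · rw [hva, hab']
            exact ⟨down_mem _ _, fun h => hab.ne' (hi h)⟩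
          · rw [hother v hva hvb]
            exact ⟨down_mem _ _, fun h => hva (hi h)⟩
      · rintro (⟨hI, hne⟩ | rfl)
        · rw [(Psi G w).tubes_eq_range] at hI
          obtain ⟨v, rfl⟩ := hI
          have hva : v ≠ a := fun h => hne (by rw [h])
          by_cases hvb : v = b
          · rw [hvb, ← hab']
            exact down_mem _ _
          · rw [← hother v hva hvb]
            exact down_mem _ _
        · exact down_mem _ _
  · have hc' : b ∉ component G S a := fun h =>
      hc (component_eq_of_mem hSa h ▸ mem_component_self hSa)
    have hdown : down (Psi G u).tubes = down (Psi G w).tubes := by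
      funext v
      by_cases hva : v = a
      · rw [hva, hua, hwa, component_diff_singleton hSa hc']
      · by_cases hvb : v = b
        · rw [hvb, hub, hwb, component_diff_singleton hSb hc]
        · exact hother v hva hvb
    have : Psi G u = Psi G w := MaxTubing.ext_tubes (by
      rw [(Psi G u).tubes_eq_range, (Psi G w).tubes_eq_range, hdown])
    rw [this]
    exact Relation.ReflTransGen.refl

/-- Climb from `w` to `w'` by adjacent swaps, each adding one missing inversion. -/
theorem WeakLE.tubingLE_Psi {w w' : Equiv.Perm (Fin n)} (h : WeakLE w w') :
    TubingLE (Psi G w) (Psi G w') := by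
  induction hk : (inversions w' \ inversions w).ncard using Nat.strong_induction_on
    generalizing w with
  | _ k ih =>
    by_cases hne : w = w'
    · rw [hne]
      exact Relation.ReflTransGen.refl
    · obtain ⟨a, b, hab, hw, hinv⟩ := h.exists_ascent hne
      have hi := inversions_trans_swap hab hw
      have hnot : (a, b) ∉ inversions w := fun h' => by
        have := Fin.lt_def.1 h'.2
        simp only at this
        omega
      refine Relation.ReflTransGen.trans (tubingLE_Psi_trans_swap w hab hw)
        (ih _ ?_ (w := w.trans (Equiv.swap a b)) ?_ rfl)
      · rw [← hk, hi]
        refine Set.ncard_lt_ncard ⟨?_, fun h' => (h' ⟨hinv, hnot⟩).2 (Or.inl rfl)⟩ (Set.toFinite _)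
        exact Set.sdiff_subset_sdiff_right (Set.subset_insert _ _)
      · intro p hp
        rw [hi] at hp
        rcases hp with rfl | hp
        · exact hinv
        · exact h hp

/-- Cotransitivity is transitivity of the tree order. For transitivity, if `i ∈ down X.tubes k` but
`j` is not, then `j` is adjacent to that tube, so `down X.tubes j` contains it and hence `i`. -/
theorem exists_maxExtension (hG : LeftFilled G) (X : MaxTubing G) :
    ∃ w : Equiv.Perm (Fin n), ∀ i k, i < k → (w.symm k < w.symm i ↔ i ∉ down X.tubes k) := by
  apply exists_perm_of_biclosed
  · intro i j k hij hjk hi hj hik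
    obtain ⟨x, hx, hxj⟩ := hG.exists_adj_of_between (isTube_down X k) hik (mem_down_self k)
      hij hjk hj
    exact hi (down_subset_down_of_adj hx hj hxj hik)
  · intro i j k _ _ hik
    by_contra! h
    exact hik (down_subset_down h.2 h.1)

/-- The largest permutation in the fibre of `Ψ` over `X`. -/
noncomputable def maxExtension (hG : LeftFilled G) (X : MaxTubing G) : Equiv.Perm (Fin n) :=
  (exists_maxExtension hG X).choose

theorem mem_inversions_maxExtension (hG : LeftFilled G) (X : MaxTubing G) {i k : Fin n} :
    (i, k) ∈ inversions (maxExtension hG X) ↔ i < k ∧ i ∉ down X.tubes k :=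
  and_congr_right fun h => (exists_maxExtension hG X).choose_spec i k h

theorem Psi_maxExtension (hG : LeftFilled G) (X : MaxTubing G) :
    Psi G (maxExtension hG X) = X := by
  apply Psi_eq_of_forall_mem_down
  intro u v huv
  rcases lt_trichotomy u v with h | rfl | h
  · by_contra hn
    exact ((mem_inversions_maxExtension hG X).1 ⟨h, not_le.1 hn⟩).2 huv
  · exact le_rfl
  · refine ((mem_inversions_maxExtension hG X).2 ⟨h, fun h' => ?_⟩).2.le
    exact h.ne (eq_of_mem_down_of_mem_down h' huv)

theorem weakLE_maxExtension_iff (hG : LeftFilled G) (w : Equiv.Perm (Fin n)) (Y : MaxTubing G) :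
    WeakLE w (maxExtension hG Y) ↔
      ∀ i k, i < k → i ∈ down Y.tubes k → w.symm i < w.symm k := by
  constructor
  · intro h i k hik hi
    by_contra hn
    have hlt : w.symm k < w.symm i :=
      lt_of_le_of_ne (not_lt.1 hn) fun e => hik.ne' (w.symm.injective e)
    exact ((mem_inversions_maxExtension hG Y).1
      (h (show (i, k) ∈ inversions w from ⟨hik, hlt⟩))).2 hi
  · rintro h ⟨i, k⟩ ⟨hik, hlt⟩
    exact (mem_inversions_maxExtension hG Y).2 ⟨hik, fun hi => hlt.not_gt (h i k hik hi)⟩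

theorem maxExtension_weakLE_iff (hG : LeftFilled G) :
    WeakLE (maxExtension hG X) (maxExtension hG Y) ↔
      ∀ i k, i < k → i ∈ down Y.tubes k → i ∈ down X.tubes k := by
  constructor
  · intro h i k hik hi
    by_contra hn
    exact ((mem_inversions_maxExtension hG Y).1
      (h ((mem_inversions_maxExtension hG X).2 ⟨hik, hn⟩))).2 hi
  · rintro h ⟨i, k⟩ hp
    rw [mem_inversions_maxExtension] at hp ⊢
    exact ⟨hp.1, fun hi => hp.2 (h i k hp.1 hi)⟩

theorem weakLE_maxExtension_Psi (hG : LeftFilled G) (w : Equiv.Perm (Fin n)) :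
    WeakLE w (maxExtension hG (Psi G w)) := by
  rw [weakLE_maxExtension_iff]
  intro i k hik hi
  rw [down_Psi] at hi
  exact lt_of_le_of_ne (component_subset hi) fun e => hik.ne (w.symm.injective e)

/-- Flips upwards shrink the part of each tube that lies below its top. -/
theorem Flip.mem_down (hG : LeftFilled G) (h : Flip X Y) {i k : Fin n} (hik : i < k)
    (hi : i ∈ down Y.tubes k) : i ∈ down X.tubes k := by
  obtain ⟨I, J, hI, hJI, hY, a, b, ha, hb, hab⟩ := h
  have hJ : J ∈ Y.tubes := hY ▸ Or.inr rfl
  obtain rfl := (isTopOf_iff hI).1 ha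
  obtain rfl := (isTopOf_iff hJ).1 hb
  have hX' : ∀ v, v ≠ a → down X.tubes v ∈ Y.tubes := fun v hv =>
    hY ▸ Or.inl ⟨down_mem X v, fun h => hv (down_injective X h)⟩
  by_cases hka : k = a
  · subst hka
    have hY' : ∀ v, v ≠ b → down Y.tubes v ∈ X.tubes := fun v hv => by
      have h := hY.le (down_mem Y v)
      exact (h.resolve_right fun h => hv (down_injective Y h)).1
    have heq : ∀ v, v ≠ k → v ≠ b → down X.tubes v = down Y.tubes v := fun v h1 h2 =>
      subset_antisymm (down_subset (hY' v h2) (mem_down_self v))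
        (down_subset (hX' v h1) (mem_down_self v))
    have hT : down Y.tubes k = down X.tubes b := by
      obtain ⟨v, hv⟩ := Y.tubes_eq_range.le (hX' b hab.ne')
      have hvb : v ≠ b := by
        rintro rfl
        have hsub : Y.tubes ⊆ X.tubes := hY ▸ Set.union_subset Set.sdiff_subset
          (Set.singleton_subset_iff.2 (hv ▸ down_mem X v))
        have hXY := Y.isMaximal.eq_of_ge X.isMaximal.1 hsub
        exact (hY.le (hXY ▸ hI)).elim (fun h => h.2 rfl) fun h => hJI h.symm
      by_cases hvk : v = k
      · exact hvk ▸ hv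
      · exact absurd (down_injective X ((heq v hvk hvb).trans hv)) hvb
    -- Otherwise an edge leaves `down X.tubes k` at some `u ≤ k` in `down Y.tubes k`. As `u < b` and
    -- `u ≠ k`, the flip keeps the smallest tube of `u`, which contains `k` by adjacency; this
    -- contradicts antisymmetry of the tree order of `Y`.
    by_contra hn
    have hkT : k ∈ down Y.tubes k ∩ Set.Iic k := ⟨mem_down_self k, le_refl k⟩
    have hC := isTube_component (G := G) hkT
    obtain ⟨x, -, u, hu, hxI, huI, hxu⟩ := hC.exists_boundary (down X.tubes k)
      (mem_component_self hkT) (hG.mem_component (isTube_down Y k) hi (mem_down_self k) hik.le)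
      (mem_down_self k) hn
    have hu' := component_subset hu
    have hub : u ≠ b := fun h => hab.not_ge (h ▸ hu'.2)
    have huk : u ≠ k := by
      rintro rfl
      exact huI (mem_down_self u)
    have hku : k ∈ down Y.tubes u :=
      (heq u huk hub).le (down_subset_down_of_adj hxI huI hxu (mem_down_self k))
    exact huk (eq_of_mem_down_of_mem_down hu'.1 hku)
  -- Here `down X.tubes k` survives the flip, so it contains the smallest tube of `Y` at `k`.
  · exact down_subset (hX' k hka) (mem_down_self k) hi

theorem TubingLE.weakLE_maxExtension (hG : LeftFilled G) (h : TubingLE X Y) :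
    WeakLE (maxExtension hG X) (maxExtension hG Y) := by
  rw [maxExtension_weakLE_iff]
  intro i k hik
  induction h with
  | refl => exact id
  | tail _ h ih => exact fun hi => ih (h.mem_down hG hik hi)

end Flips

theorem mainTheorem5 (n : ℕ) (G : SimpleGraph (Fin n)) (hG : LeftFilled G) :
    ∃ (_ : Lattice (Equiv.Perm (Fin n))) (_ : Lattice (MaxTubing G)),
      (∀ w w' : Equiv.Perm (Fin n), w ≤ w' ↔ WeakLE w w') ∧
      (∀ X Y : MaxTubing G, X ≤ Y ↔ TubingLE X Y) ∧
      ∀ w w' : Equiv.Perm (Fin n), Psi G (w ⊔ w') = Psi G w ⊔ Psi G w' := by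
  let _ : CompleteLattice (Equiv.Perm (Fin n)) := weakOrder n
  let _ : PartialOrder (MaxTubing G) :=
    { le := TubingLE
      le_refl := fun _ => Relation.ReflTransGen.refl
      le_trans := fun _ _ _ => Relation.ReflTransGen.trans
      -- Antisymmetry is inherited from the weak order, since `maxExtension` is monotone and has
      -- `Psi G` as left inverse.
      le_antisymm := fun X Y h h' => by
        rw [← Psi_maxExtension hG X, ← Psi_maxExtension hG Y,
          (h.weakLE_maxExtension hG).antisymm (h'.weakLE_maxExtension hG)] }
  have gi : GaloisInsertion (Psi G) (maxExtension hG) :=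
    GaloisInsertion.monotoneIntro (fun _ _ h => h.weakLE_maxExtension hG)
      (fun _ _ h => WeakLE.tubingLE_Psi h) (weakLE_maxExtension_Psi hG) (Psi_maxExtension hG)
  let _ : CompleteLattice (MaxTubing G) := gi.liftCompleteLattice
  exact ⟨inferInstance, inferInstance, fun _ _ => Iff.rfl, fun _ _ => Iff.rfl,
    fun _ _ => gi.gc.l_sup⟩
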